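/- Let $\mathcal{C}$ be a (not necessarily symmetric) monoidal category. Suppose that: 1. $\mathcal{C}$ has regular factorizations, i.e. every source $(f_i\colon X\to Y_i)_{i\in I}$ in $\mathcal{C}$ ($I$ a possibly empty set or a proper class) can be written as $f_i=m_i\circ e$ for all $i\in I$, with $e\colon X\to Z$ a regular epimorphism (a coequalizer of some pair of morphisms) and $(m_i\colon Z\to Y_i)_{i\in I}$ a mono-source (if $m_i\circ r=m_i\circ s$ for all $i$, then $r=s$); 2. $\mathcal{C}$ has denumerable (that is, $\mathbb{N}$-indexed) coproducts; 3. for each object $X$ of $\mathcal{C}$ the functors $X\otimes-$ and $-\otimes X$ preserve denumerable coproducts and regular epimorphisms. Then the category $\mathbf{Mon}\,\mathcal{C}$ of monoids in $\mathcal{C}$ has coequalizers and all other colimits which exist in $\mathcal{C}$: if $|-|\colon\mathbf{Mon}\,\mathcal{C}\to\mathcal{C}$ denotes the forgetful functor, then every diagram $D\colon J\to\mathbf{Mon}\,\mathcal{C}$ for which $|-|\circ D$ has a colimit in $\mathcal{C}$ has a colimit in $\mathbf{Mon}\,\mathcal{C}$. In particular, if $\mathcal{C}$ is cocomplete, then so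 is $\mathbf{Mon}\,\mathcal{C}$. -/

import Mathlib

open CategoryTheory CategoryTheory.Limits

universe w' w v u

/-- A source `(m i : X ⟶ Y i)` is a mono-source if it is jointly left-cancellable: two morphisms
into `X` that agree after composition with every `m i` are equal. -/
def IsMonoSource {C : Type u} [Category.{v} C] {X : C} {I : Type*} {Y : I → C}
    (m : ∀ i, X ⟶ Y i) : Prop :=
  ∀ ⦃Z : C⦄ (r s : Z ⟶ X), (∀ i, r ≫ m i = s ≫ m i) → r = s

/-- `C` has regular factorizations if every source in `C` factors as a regular epimorphism
followed by a mono-source. A source may be empty or indexed by a proper class; an index type in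
`Type (max u v)`, the universe of the collection of all morphisms of `C`, accounts for this. -/
def HasRegularFactorizations (C : Type u) [Category.{v} C] : Prop :=
  ∀ (X : C) (I : Type (max u v)) (Y : I → C) (f : ∀ i, X ⟶ Y i),
    ∃ (Z : C) (e : X ⟶ Z) (m : ∀ i, Z ⟶ Y i),
      IsRegularEpi e ∧ IsMonoSource m ∧ ∀ i, e ≫ m i = f i

/-- Tensoring preserves regular epimorphisms: the functors `X ⊗ -` and `- ⊗ X` do, for all `X`. -/
def TensorPreservesRegularEpis (C : Type u) [Category.{v} C] [MonoidalCategory C] : Prop :=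
  ∀ (X : C) ⦃A B : C⦄ (f : A ⟶ B), IsRegularEpi f →
    IsRegularEpi ((MonoidalCategory.tensorLeft X).map f) ∧
      IsRegularEpi ((MonoidalCategory.tensorRight X).map f)

/-! Regular epimorphisms have the diagonal fill-in property against mono-sources, and that property
is closed under composition. Hence if a source of monoid morphisms factors in `C` as `e` followed by
a mono-source, the multiplication descends along `e ⊗ₘ e`, and the monoid laws can be tested on the
mono-source: the factorization lives in `Mon C`. A colimit of `D` is then a quotient of the free
monoid on the colimit `K` of the underlying objects: factor the source of all morphisms out of it
that become monoid morphisms on each `D.obj j`. Coequalizers arise likewise from the source of all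
coequalizing morphisms. -/

open MonoidalCategory MonObj

/-! ### Factorizations of sources of monoid morphisms -/

section Factorization

variable {C : Type u} [Category.{v} C]

/-- Diagonal fill-in property of a morphism `p` against mono-sources. -/
def LiftsAgainstMonoSources {A B : C} (p : A ⟶ B) : Prop :=
  ∀ ⦃I : Type (max u v)⦄ ⦃X : C⦄ ⦃Y : I → C⦄ (m : ∀ i, X ⟶ Y i) (_ : IsMonoSource m)
    (a : A ⟶ X) (b : ∀ i, B ⟶ Y i), (∀ i, a ≫ m i = p ≫ b i) →
    ∃ d : B ⟶ X, p ≫ d = a ∧ ∀ i, d ≫ m i = b i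

lemma CategoryTheory.IsRegularEpi.epi_of_isRegularEpi {A B : C} {p : A ⟶ B}
    (hp : IsRegularEpi p) : Epi p :=
  hp.regularEpi.some.epi

lemma CategoryTheory.IsRegularEpi.liftsAgainstMonoSources {A B : C} {p : A ⟶ B}
    (hp : IsRegularEpi p) :
    LiftsAgainstMonoSources p := by
  intro I X Y m hm a b hab
  have := hp.epi_of_isRegularEpi
  refine ⟨IsRegularEpi.desc p a (hm _ _ fun i => ?_), IsRegularEpi.fac _ _ _, fun i => ?_⟩
  · simp only [Category.assoc, hab, reassoc_of% IsRegularEpi.w p]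
  · rw [← cancel_epi p, IsRegularEpi.fac_assoc, hab]

lemma LiftsAgainstMonoSources.comp {A B D : C} {p : A ⟶ B} {q : B ⟶ D}
    (hp : LiftsAgainstMonoSources p) (hq : LiftsAgainstMonoSources q) :
    LiftsAgainstMonoSources (p ≫ q) := by
  intro I X Y m hm a b hab
  obtain ⟨d, hd, hdm⟩ := hp m hm a (fun i => q ≫ b i) (by simpa using hab)
  obtain ⟨d', hd', hdm'⟩ := hq m hm d b hdm
  exact ⟨d', by simp [hd', hd], hdm'⟩

variable [MonoidalCategory C]

/-- Regular factorizations lift from `C` to `Mon C` when tensoring preserves regular epis. -/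
theorem CategoryTheory.Mon.exists_factorization (hfact : HasRegularFactorizations C)
    (hepi : TensorPreservesRegularEpis C) (F : Mon C) {I : Type (max u v)} (M : I → Mon C)
    (g : ∀ i, F ⟶ M i) :
    ∃ (Q : Mon C) (e : F ⟶ Q) (m : ∀ i, Q ⟶ M i), Epi e.hom ∧
      IsMonoSource (fun i => (m i).hom) ∧ ∀ i, e ≫ m i = g i := by
  obtain ⟨Q, e, m, he, hm, hem⟩ := hfact F.X I (fun i => (M i).X) (fun i => (g i).hom)
  -- A composite of regular epimorphisms need not be regular, but only the lifting property is
  -- needed.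
  have hee : LiftsAgainstMonoSources (e ⊗ₘ e) := by
    rw [MonoidalCategory.tensorHom_def]
    exact (hepi F.X e he).2.liftsAgainstMonoSources.comp (hepi Q e he).1.liftsAgainstMonoSources
  obtain ⟨q, heq, hqm⟩ := hee m hm (μ[F.X] ≫ e) (fun i => (m i ⊗ₘ m i) ≫ μ[(M i).X]) (by
    intro i
    rw [Category.assoc, hem, IsMonHom.mul_hom, tensorHom_comp_tensorHom_assoc, hem])
  have hone (i : I) : (η[F.X] ≫ e) ≫ m i = η[(M i).X] := by
    rw [Category.assoc, hem, IsMonHom.one_hom]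
  let _ : MonObj Q :=
    { one := η[F.X] ≫ e
      mul := q
      one_mul := hm _ _ fun i => by
        rw [Category.assoc, hqm, ← tensorHom_id, tensorHom_comp_tensorHom_assoc, hone,
          Category.id_comp, one_mul_hom]
      mul_one := hm _ _ fun i => by
        rw [Category.assoc, hqm, ← id_tensorHom, tensorHom_comp_tensorHom_assoc, hone,
          Category.id_comp, mul_one_hom]
      mul_assoc := hm _ _ fun i => by
        simp only [Category.assoc, hqm]
        rw [← tensorHom_id, ← id_tensorHom, tensorHom_comp_tensorHom_assoc,
          tensorHom_comp_tensorHom_assoc, hqm, Category.id_comp]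
        have h₁ : (((m i ⊗ₘ m i) ≫ μ[(M i).X]) ⊗ₘ m i) =
            ((m i ⊗ₘ m i) ⊗ₘ m i) ≫ μ[(M i).X] ▷ (M i).X := by
          rw [← tensorHom_id, tensorHom_comp_tensorHom, Category.comp_id]
        have h₂ : (m i ⊗ₘ ((m i ⊗ₘ m i) ≫ μ[(M i).X])) =
            (m i ⊗ₘ (m i ⊗ₘ m i)) ≫ (M i).X ◁ μ[(M i).X] := by
          rw [← id_tensorHom, tensorHom_comp_tensorHom, Category.comp_id]
        rw [h₁, h₂, Category.assoc, Category.assoc, MonObj.mul_assoc, associator_naturality_assoc] }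
  have (i : I) : IsMonHom (m i) := ⟨hone i, hqm i⟩
  have : IsMonHom e := ⟨rfl, heq.symm⟩
  refine ⟨.mk Q, .mk e, fun i => .mk (m i), he.epi_of_isRegularEpi, hm, fun i => ?_⟩
  ext
  exact hem i

end Factorization

/-! ### The free monoid on an object -/

section FreeMonoid

variable {C : Type u} [Category.{v} C] [MonoidalCategory C]

/-- The iterated tensor powers of an object. -/
def tensorPow (K : C) : ℕ → C
  | 0 => 𝟙_ C
  | n + 1 => K ⊗ tensorPow K n

variable [HasColimitsOfShape (Discrete ℕ) C]

/-- The underlying object of the free monoid on `K`. -/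
noncomputable def tensorAlg (K : C) : C := ∐ tensorPow K

namespace tensorAlg

/-- The inclusion of a tensor power. -/
noncomputable def incl (K : C) (n : ℕ) : tensorPow K n ⟶ tensorAlg K := Sigma.ι (tensorPow K) n

/-- The unit of the free monoid. -/
noncomputable def unit (K : C) : 𝟙_ C ⟶ tensorAlg K := incl K 0

/-- The inclusions exhibit `tensorAlg K` as a coproduct. -/
noncomputable def isColimit (K : C) : IsColimit (Cofan.mk (tensorAlg K) (incl K)) :=
  coproductIsCoproduct (tensorPow K)

section

variable [∀ X : C, PreservesColimitsOfShape (Discrete ℕ) (tensorLeft X)]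

/-- `- ⊗ tensorAlg K` is a coproduct. -/
noncomputable def isColimitLeft (X K : C) :
    IsColimit (Cofan.mk (X ⊗ tensorAlg K) (fun n => X ◁ incl K n)) :=
  isColimitCofanMkObjOfIsColimit (tensorLeft X) _ _ (isColimit K)

/-- Multiplication by a generator on the left. -/
noncomputable def cons (K : C) : K ⊗ tensorAlg K ⟶ tensorAlg K :=
  Cofan.IsColimit.desc (isColimitLeft K K) (fun n => incl K (n + 1))

lemma incl_cons (K : C) (n : ℕ) : K ◁ incl K n ≫ cons K = incl K (n + 1) :=
  Cofan.IsColimit.fac (isColimitLeft K K) (fun n => incl K (n + 1)) n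

end

section

variable [∀ X : C, PreservesColimitsOfShape (Discrete ℕ) (tensorRight X)]

/-- `tensorAlg K ⊗ A` is a coproduct. -/
noncomputable def isColimitRight (K A : C) :
    IsColimit (Cofan.mk (tensorAlg K ⊗ A) (fun n => incl K n ▷ A)) :=
  isColimitCofanMkObjOfIsColimit (tensorRight A) _ _ (isColimit K)

/-- The restrictions of `recMap` to the tensor powers. -/
noncomputable def recComp {K A B : C} (a : A ⟶ B) (b : K ⊗ B ⟶ B) : ∀ n, tensorPow K n ⊗ A ⟶ B
  | 0 => (λ_ A).hom ≫ a
  | n + 1 => (α_ K (tensorPow K n) A).hom ≫ K ◁ recComp a b n ≫ b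

/-- The parametrized recursor: `tensorAlg K ⊗ A` is the free `K ⊗ -`-algebra on `A`. -/
noncomputable def recMap {K A B : C} (a : A ⟶ B) (b : K ⊗ B ⟶ B) : tensorAlg K ⊗ A ⟶ B :=
  Cofan.IsColimit.desc (isColimitRight K A) (recComp a b)

lemma incl_recMap {K A B : C} (a : A ⟶ B) (b : K ⊗ B ⟶ B) (n : ℕ) :
    incl K n ▷ A ≫ recMap a b = recComp a b n :=
  Cofan.IsColimit.fac (isColimitRight K A) (recComp a b) n

lemma unit_recMap {K A B : C} (a : A ⟶ B) (b : K ⊗ B ⟶ B) :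
    unit K ▷ A ≫ recMap a b = (λ_ A).hom ≫ a :=
  incl_recMap a b 0

end

variable [∀ X : C, PreservesColimitsOfShape (Discrete ℕ) (tensorLeft X)]
variable [∀ X : C, PreservesColimitsOfShape (Discrete ℕ) (tensorRight X)]

/-- `(X ⊗ tensorAlg K) ⊗ A` is a coproduct. -/
noncomputable def isColimitLeftRight (X K A : C) :
    IsColimit (Cofan.mk ((X ⊗ tensorAlg K) ⊗ A) (fun n => (X ◁ incl K n) ▷ A)) :=
  isColimitCofanMkObjOfIsColimit (tensorRight A) _ _ (isColimitLeft X K)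

lemma cons_recMap {K A B : C} (a : A ⟶ B) (b : K ⊗ B ⟶ B) :
    cons K ▷ A ≫ recMap a b = (α_ K (tensorAlg K) A).hom ≫ K ◁ recMap a b ≫ b := by
  refine Cofan.IsColimit.hom_ext (isColimitLeftRight K K A) _ _ fun n => ?_
  change (K ◁ incl K n) ▷ A ≫ cons K ▷ A ≫ recMap a b =
    (K ◁ incl K n) ▷ A ≫ (α_ K (tensorAlg K) A).hom ≫ K ◁ recMap a b ≫ b
  rw [← comp_whiskerRight_assoc, incl_cons, associator_naturality_middle_assoc,
    ← whiskerLeft_comp_assoc, incl_recMap]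
  exact incl_recMap a b (n + 1)

/-- Induction on the tensor power, since each inclusion of index `n + 1` factors through `cons`.
This uniqueness yields all the monoid laws below. -/
lemma eq_recMap {K A B : C} {a : A ⟶ B} {b : K ⊗ B ⟶ B} {h : tensorAlg K ⊗ A ⟶ B}
    (h₀ : unit K ▷ A ≫ h = (λ_ A).hom ≫ a)
    (h₁ : cons K ▷ A ≫ h = (α_ K (tensorAlg K) A).hom ≫ K ◁ h ≫ b) : h = recMap a b := by
  refine Cofan.IsColimit.hom_ext (isColimitRight K A) _ _ fun n => ?_
  change incl K n ▷ A ≫ h = incl K n ▷ A ≫ recMap a b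
  rw [incl_recMap]
  induction n with
  | zero => exact h₀
  | succ n ih =>
    have key : (K ◁ incl K n ≫ cons K) ▷ A ≫ h =
        (α_ K (tensorPow K n) A).hom ≫ K ◁ recComp a b n ≫ b := by
      rw [← ih, comp_whiskerRight_assoc, h₁, associator_naturality_middle_assoc,
        whiskerLeft_comp_assoc]
    rwa [incl_cons] at key

noncomputable instance (K : C) : MonObj (tensorAlg K) where
  one := unit K
  mul := recMap (𝟙 _) (cons K)
  one_mul := by rw [unit_recMap, Category.comp_id]
  mul_one := by
    -- Both sides solve the same recursion; associativity is handled the same way.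
    trans recMap (unit K) (cons K)
    · apply eq_recMap
      · rw [← whisker_exchange_assoc, unit_recMap, Category.comp_id, leftUnitor_naturality]
      · rw [← whisker_exchange_assoc, cons_recMap, whiskerLeft_comp_assoc,
          associator_naturality_right_assoc]
    · symm
      apply eq_recMap
      · rw [rightUnitor_naturality, unitors_equal]
      · rw [rightUnitor_naturality, rightUnitor_tensor_hom_assoc]
  mul_assoc := by
    rw [← cancel_epi (α_ (tensorAlg K) (tensorAlg K) (tensorAlg K)).inv, Iso.inv_hom_id_assoc]
    trans recMap (recMap (𝟙 _) (cons K)) (cons K)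
    · apply eq_recMap
      · rw [associator_inv_naturality_left_assoc, ← comp_whiskerRight_assoc, unit_recMap]
        simp
      · rw [associator_inv_naturality_left_assoc, ← comp_whiskerRight_assoc, cons_recMap]
        simp [cons_recMap]
    · symm
      apply eq_recMap
      · rw [← whisker_exchange_assoc, unit_recMap]; simp
      · rw [← whisker_exchange_assoc, cons_recMap]; simp

/-- The inclusion of generators. -/
noncomputable def of (K : C) : K ⟶ tensorAlg K := (ρ_ K).inv ≫ K ◁ unit K ≫ cons K

lemma of_mul (K : C) : of K ▷ tensorAlg K ≫ μ[tensorAlg K] = cons K := by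
  change _ ≫ recMap _ _ = _
  simp only [of, comp_whiskerRight, Category.assoc, cons_recMap]
  rw [associator_naturality_middle_assoc, ← whiskerLeft_comp_assoc, unit_recMap]
  simp

lemma cons_hom {K : C} {M : C} [MonObj M] (r : tensorAlg K ⟶ M) [IsMonHom r] :
    cons K ≫ r = K ◁ r ≫ (of K ≫ r) ▷ M ≫ μ[M] := by
  rw [← of_mul, Category.assoc, IsMonHom.mul_hom, MonoidalCategory.tensorHom_def, Category.assoc,
    ← comp_whiskerRight_assoc, ← whisker_exchange_assoc]

lemma hom_ext {K : C} {M : Mon C} {r s : Mon.mk (tensorAlg K) ⟶ M}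
    (h : of K ≫ r.hom = of K ≫ s.hom) : r = s := by
  -- Taking `A = 𝟙_ C`, the recursion solved by `r` involves only its restriction to generators.
  have key (r : Mon.mk (tensorAlg K) ⟶ M) : (ρ_ (tensorAlg K)).hom ≫ r.hom =
      recMap η[M.X] ((of K ≫ r.hom) ▷ M.X ≫ μ[M.X]) := by
    apply eq_recMap
    · rw [rightUnitor_naturality_assoc, unitors_equal]
      exact congrArg _ (IsMonHom.one_hom r.hom)
    · have := cons_hom r.hom
      rw [rightUnitor_naturality_assoc, this]
      simp
  ext
  rw [← cancel_epi (ρ_ (tensorAlg K)).hom, key, key, h]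

lemma exists_desc {K : C} (M : Mon C) (f : K ⟶ M.X) :
    ∃ r : Mon.mk (tensorAlg K) ⟶ M, of K ≫ r.hom = f := by
  let b := f ▷ M.X ≫ μ[M.X]
  let φ : tensorAlg K ⟶ M.X := (ρ_ _).inv ≫ recMap η[M.X] b
  have h₀ : unit K ≫ φ = η[M.X] := by
    simp only [φ]
    rw [rightUnitor_inv_naturality_assoc, unit_recMap, ← unitors_inv_equal, Iso.inv_hom_id_assoc]
  have h₁ : cons K ≫ φ = K ◁ φ ≫ b := by
    simp only [φ]
    rw [rightUnitor_inv_naturality_assoc, cons_recMap]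
    simp
  have : IsMonHom φ := by
    refine ⟨h₀, ?_⟩
    change recMap _ _ ≫ φ = _
    -- Multiplicativity: both composites start at `φ` and iterate `b`.
    trans recMap φ b
    · apply eq_recMap
      · rw [reassoc_of% unit_recMap (K := K) (𝟙 (tensorAlg K)) (cons K)]
      · rw [reassoc_of% cons_recMap (K := K) (𝟙 (tensorAlg K)) (cons K), h₁,
          ← whiskerLeft_comp_assoc]
    · symm
      apply eq_recMap
      · rw [MonoidalCategory.tensorHom_def, Category.assoc, ← comp_whiskerRight_assoc, h₀,
          ← whisker_exchange_assoc, MonObj.one_mul, leftUnitor_naturality]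
      · rw [MonoidalCategory.tensorHom_def, Category.assoc, ← comp_whiskerRight_assoc, h₁]
        simp only [b, comp_whiskerRight, Category.assoc]
        rw [← whisker_exchange_assoc, MonObj.mul_assoc]
        have key := whisker_exchange_assoc f (M.X ◁ φ) (M.X ◁ μ[M.X] ≫ μ[M.X])
        simp only [whiskerRight_tensor, Category.assoc] at key
        simp [whisker_exchange_assoc, key]
  refine ⟨.mk φ, ?_⟩
  change of K ≫ φ = f
  rw [of, Category.assoc, Category.assoc, h₁, ← whiskerLeft_comp_assoc, h₀]
  simp only [b]
  rw [whisker_exchange_assoc, MonObj.mul_one]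
  simp

end tensorAlg

end FreeMonoid

/-! ### Colimits of monoids -/

section Colimits

variable {C : Type u} [Category.{v} C] [MonoidalCategory C]

theorem CategoryTheory.Mon.hasCoequalizers_of_hasRegularFactorizations
    (hfact : HasRegularFactorizations C) (hepi : TensorPreservesRegularEpis C) :
    HasCoequalizers (Mon C) := by
  refine @hasCoequalizers_of_hasColimit_parallelPair _ _ fun {A B f g} => ?_
  let I : Type (max u v) := Σ M : Mon C, {h : B ⟶ M // f ≫ h = g ≫ h}
  obtain ⟨Q, e, m, he, hm, hem⟩ :=
    Mon.exists_factorization hfact hepi B (I := I) (fun i => i.1) (fun i => i.2.1)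
  have w : f ≫ e = g ≫ e := by
    ext
    refine hm _ _ fun i => ?_
    exact congrArg Mon.Hom.hom (show (f ≫ e) ≫ m i = (g ≫ e) ≫ m i by
      simpa only [Category.assoc, hem] using i.2.2)
  refine ⟨⟨⟨Cofork.ofπ e w, Cofork.IsColimit.mk _ (fun s => m ⟨s.pt, s.π, s.condition⟩)
    (fun s => hem ⟨s.pt, s.π, s.condition⟩) fun s k hk => ?_⟩⟩⟩
  ext
  rw [← cancel_epi e.hom]
  exact congrArg Mon.Hom.hom (hk.trans (hem ⟨s.pt, s.π, s.condition⟩).symm)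

theorem CategoryTheory.Mon.hasColimit_of_hasColimit_forget (hfact : HasRegularFactorizations C)
    [HasColimitsOfShape (Discrete ℕ) C]
    [∀ X : C, PreservesColimitsOfShape (Discrete ℕ) (tensorLeft X)]
    [∀ X : C, PreservesColimitsOfShape (Discrete ℕ) (tensorRight X)]
    (hepi : TensorPreservesRegularEpis C) {J : Type w} [Category.{w'} J] (D : J ⥤ Mon C)
    [HasColimit (D ⋙ Mon.forget C)] : HasColimit D := by
  let K := colimit (D ⋙ Mon.forget C)
  let κ (j : J) : (D.obj j).X ⟶ tensorAlg K :=
    colimit.ι (D ⋙ Mon.forget C) j ≫ tensorAlg.of K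
  have hκ {j j' : J} (t : j ⟶ j') : (D.map t).hom ≫ κ j' = κ j :=
    colimit.w_assoc (D ⋙ Mon.forget C) t _
  let I : Type (max u v) :=
    Σ M : Mon C, {g : Mon.mk (tensorAlg K) ⟶ M // ∀ j, IsMonHom (κ j ≫ g.hom)}
  obtain ⟨Q, e, m, he, hm, hem⟩ := Mon.exists_factorization hfact hepi (Mon.mk (tensorAlg K))
    (I := I) (fun i => i.1) (fun i => i.2.1)
  have hem' (i : I) : e.hom ≫ (m i).hom = i.2.1.hom := congrArg Mon.Hom.hom (hem i)
  -- The equations hold after each `m i`, where they become the condition defining `I`.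
  have (j : J) : IsMonHom (κ j ≫ e.hom) := by
    constructor
    · refine hm _ _ fun i => ?_
      have := (i.2.2 j).one_hom
      simp only [Category.assoc, hem', IsMonHom.one_hom] at this ⊢
      exact this
    · refine hm _ _ fun i => ?_
      have := (i.2.2 j).mul_hom
      simp only [Category.assoc, hem', IsMonHom.mul_hom, tensorHom_comp_tensorHom_assoc] at this ⊢
      exact this
  let c : Cocone D :=
    ⟨Q, { app := fun j => .mk (κ j ≫ e.hom)
          naturality := fun j j' t => by
            ext
            simp [reassoc_of% hκ] }⟩
  have hdesc (s : Cocone D) : ∃ l : Q ⟶ s.pt, ∀ j, c.ι.app j ≫ l = s.ι.app j := by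
    obtain ⟨g, hg⟩ := tensorAlg.exists_desc s.pt
      (colimit.desc (D ⋙ Mon.forget C) ((Mon.forget C).mapCocone s))
    have hκg (j : J) : κ j ≫ g.hom = (s.ι.app j).hom := by
      refine (Category.assoc _ _ _).trans ((congrArg _ hg).trans ?_)
      exact colimit.ι_desc ((Mon.forget C).mapCocone s) j
    let i : I := ⟨s.pt, g, fun j => by rw [hκg]; infer_instance⟩
    refine ⟨m i, fun j => ?_⟩
    ext
    change (κ j ≫ e.hom) ≫ (m i).hom = _
    rw [Category.assoc, hem', hκg]
  choose l hl using hdesc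
  refine ⟨⟨⟨c, ⟨l, hl, fun s k hk => ?_⟩⟩⟩⟩
  have : e ≫ k = e ≫ l s := by
    apply tensorAlg.hom_ext
    refine colimit.hom_ext fun j => ?_
    have h : (κ j ≫ e.hom) ≫ k.hom = (κ j ≫ e.hom) ≫ (l s).hom :=
      congrArg Mon.Hom.hom ((hk j).trans (hl s j).symm)
    rw [Category.assoc, Category.assoc] at h
    exact (Category.assoc _ _ _).symm.trans (h.trans (Category.assoc _ _ _))
  ext
  rw [← cancel_epi e.hom]
  exact congrArg Mon.Hom.hom this

end Colimits

theorem mainTheorem2 (C : Type u) [Category.{v} C] [MonoidalCategory C]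
    (hfact : HasRegularFactorizations C)
    [HasColimitsOfShape (Discrete ℕ) C]
    [∀ X : C, PreservesColimitsOfShape (Discrete ℕ) (MonoidalCategory.tensorLeft X)]
    [∀ X : C, PreservesColimitsOfShape (Discrete ℕ) (MonoidalCategory.tensorRight X)]
    (hepi : TensorPreservesRegularEpis C) :
    HasCoequalizers (Mon C) ∧
      (∀ (J : Type w) [Category.{w'} J] (D : J ⥤ Mon C),
        HasColimit (D ⋙ Mon.forget C) → HasColimit D) ∧
      (HasColimits C → HasColimits (Mon C)) := by
  refine ⟨Mon.hasCoequalizers_of_hasRegularFactorizations hfact hepi,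
    fun J _ D _ => Mon.hasColimit_of_hasColimit_forget hfact hepi D, fun _ => ?_⟩
  exact ⟨fun J _ => ⟨fun D => Mon.hasColimit_of_hasColimit_forget hfact hepi D⟩⟩
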